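/- Let $G$ be a compactly presented, totally disconnected, locally compact group without non-trivial compact normal subgroups. Then there is a locally compact group $G^\dagger$ admitting $G$ as a closed cocompact subgroup such that all uniform lattices in $G^\dagger$ are locally rigid. Here a topological group is compactly presented if it admits a compact generating set $S$ and a presentation with relations of bounded length in $S$. A subgroup $L$ of a locally compact group $H$ is cocompact if $H = LK$ for some compact subset $K \subset H$, and a uniform lattice in $H$ is a discrete cocompact subgroup. A uniform lattice $\Gamma \le H$ is locally rigid if the inclusion $\Gamma \hookrightarrow H$ has a neighbourhood $\mathcal{U}$ in the space of all homomorphisms $\Gamma \to H$, with the topology of pointwise convergence, such that every $r \in \mathcal{U}$ is of the form $r(\gamma) = g\gamma g^{-1}$ for all $\gamma \in \Gamma$, for some $g \in H$ (depending on $r$). Locally compact groups are Hausdorff. -/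

import Mathlib

open Topology Pointwise

universe u v

/-- A topological group `G` is compactly presented if it has a compact generating set `S` and a
presentation `⟨S ∣ R⟩`, as an abstract group, in which the relators have bounded length as reduced
words in the letters from `S` and their inverses. -/
def IsCompactlyPresented (G : Type u) [Group G] [TopologicalSpace G] : Prop :=
  open Classical in
  ∃ (S : Set G) (R : Set (FreeGroup S)) (n : ℕ),
    IsCompact S ∧
    Function.Surjective (FreeGroup.lift (Subtype.val : S → G)) ∧
    (∀ w ∈ R, w.norm ≤ n) ∧
    Subgroup.normalClosure R = (FreeGroup.lift (Subtype.val : S → G)).ker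

section Lattices

variable {G : Type u} [Group G] [TopologicalSpace G]

/-- A subgroup `L` of `G` is cocompact if `G = L K` for some compact subset `K` of `G`. -/
def IsCocompactSubgroup (L : Subgroup G) : Prop :=
  ∃ K : Set G, IsCompact K ∧ (L : Set G) * K = Set.univ

/-- A uniform lattice is a discrete cocompact subgroup. -/
def IsUniformLattice (Γ : Subgroup G) : Prop :=
  DiscreteTopology Γ ∧ IsCocompactSubgroup Γ

/-- The topology of pointwise convergence on the set of all group homomorphisms from a (discrete)
group `Γ` to `G`; with it, `Γ →* G` is the representation space of `Γ` in `G`. -/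
abbrev representationTopology (Γ : Type v) [Group Γ] (G : Type u) [Group G] [TopologicalSpace G] :
    TopologicalSpace (Γ →* G) :=
  TopologicalSpace.induced (fun r : Γ →* G => (r : Γ → G)) Pi.topologicalSpace

/-- `Γ` is locally rigid in `G` if the inclusion homomorphism has an open neighbourhood in the
representation space of `Γ` in `G` all of whose points arise from the inclusion by conjugation by
an element of `G`. -/
def IsLocallyRigid (Γ : Subgroup G) : Prop :=
  ∃ U : Set (Γ →* G), IsOpen[representationTopology Γ G] U ∧ Γ.subtype ∈ U ∧
    ∀ r ∈ U, ∃ g : G, ∀ γ : Γ, r γ = g * (γ : G) * g⁻¹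

end Lattices

/-!
Let `U` be a compact open subgroup of `G`, let `X` be the Cayley–Abels graph of `G` on `G ⧸ U`, and
let `H` be the automorphism group of `X`. Given a uniform lattice `Γ` of `H`, choose a large finite
part `B` of `X` whose `Γ`-translates cover `X`. A representation `r` close to the inclusion agrees
with it on `B` for the finitely many elements of `Γ` that do not move `B` off itself, so extending
the identity of `B` equivariantly gives a map `φ` from `X` to `X`. On every ball of a fixed large
radius, `φ` coincides with an automorphism, hence `φ` is a covering at a large scale. The relators
of `G` have bounded length, so path lifting along such a covering defines an action of `G`, and this
forces the covering to be injective. Hence `φ` is an automorphism, and it conjugates the inclusion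
to `r`.
-/

section PermutationTopology

variable {α : Type*} {r : α → α → Prop}

theorem range_relIso_coe_inv :
    Set.range (fun σ : r ≃r r => ((σ : α → α), ((σ⁻¹ : r ≃r r) : α → α))) =
      {p | (∀ x, p.1 (p.2 x) = x) ∧ (∀ x, p.2 (p.1 x) = x) ∧
        ∀ x y, r (p.1 x) (p.1 y) ↔ r x y} := by
  ext p
  constructor
  · rintro ⟨σ, rfl⟩
    exact ⟨σ.apply_inv_self, σ.inv_apply_self, fun _ _ => σ.map_rel_iff⟩
  · rintro ⟨hright, hleft, hrel⟩
    exact ⟨⟨⟨p.1, p.2, hleft, hright⟩, hrel _ _⟩, rfl⟩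

variable [TopologicalSpace α]

/-- The permutation topology on the automorphism group of a relation: pointwise convergence of
automorphisms and of their inverses. -/
instance relIsoPermutationTopology : TopologicalSpace (r ≃r r) :=
  .induced (fun σ => ((σ : α → α), ((σ⁻¹ : r ≃r r) : α → α))) inferInstance

theorem isInducing_relIso_coe_inv :
    IsInducing fun σ : r ≃r r => ((σ : α → α), ((σ⁻¹ : r ≃r r) : α → α)) := ⟨rfl⟩

theorem continuous_relIso_apply (x : α) : Continuous fun σ : r ≃r r => σ x :=
  (continuous_apply x).comp (continuous_fst.comp isInducing_relIso_coe_inv.continuous)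

theorem continuous_relIso_inv_apply (x : α) : Continuous fun σ : r ≃r r => σ⁻¹ x :=
  (continuous_apply x).comp (continuous_snd.comp isInducing_relIso_coe_inv.continuous)

theorem continuous_relIso_iff {β : Type*} [TopologicalSpace β] {f : β → (r ≃r r)} :
    Continuous f ↔ (∀ x, Continuous fun b => f b x) ∧ ∀ x, Continuous fun b => (f b)⁻¹ x := by
  rw [isInducing_relIso_coe_inv.continuous_iff, ← continuous_pi_iff, ← continuous_pi_iff]
  exact continuous_prodMk (f := fun b => ⇑(f b)) (g := fun b => ⇑(f b)⁻¹)

instance relIso_t2Space [T2Space α] : T2Space (r ≃r r) :=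
  .of_injective_continuous (fun _ _ h => DFunLike.coe_injective (Prod.ext_iff.1 h).1)
    isInducing_relIso_coe_inv.continuous

variable [DiscreteTopology α]

instance relIso_isTopologicalGroup : IsTopologicalGroup (r ≃r r) where
  continuous_mul := by
    have happly : Continuous fun p : (r ≃r r) × α => p.1 p.2 :=
      continuous_prod_of_discrete_right.2 continuous_relIso_apply
    have hinv_apply : Continuous fun p : (r ≃r r) × α => p.1⁻¹ p.2 :=
      continuous_prod_of_discrete_right.2 continuous_relIso_inv_apply
    refine continuous_relIso_iff.2 ⟨fun x => ?_, fun x => ?_⟩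
    · exact happly.comp
        (continuous_fst.prodMk ((continuous_relIso_apply x).comp continuous_snd))
    · simp only [mul_inv_rev]
      exact hinv_apply.comp
        (continuous_snd.prodMk ((continuous_relIso_inv_apply x).comp continuous_fst))
  continuous_inv := continuous_relIso_iff.2
    ⟨continuous_relIso_inv_apply, by simpa only [inv_inv] using continuous_relIso_apply⟩

theorem isOpen_setOf_relIso_apply_eq (x y : α) : IsOpen {σ : r ≃r r | σ x = y} :=
  (isOpen_discrete {y}).preimage (continuous_relIso_apply x)

theorem isClosedEmbedding_relIso_coe_inv :
    IsClosedEmbedding fun σ : r ≃r r => ((σ : α → α), ((σ⁻¹ : r ≃r r) : α → α)) := by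
  refine ⟨isInducing_relIso_coe_inv.isEmbedding, ?_⟩
  have heval : Continuous fun p : (α → α) × α => p.1 p.2 :=
    continuous_prod_of_discrete_right.2 continuous_apply
  have hfst (x : α) : Continuous fun p : (α → α) × (α → α) => p.1 x :=
    (continuous_apply x).comp continuous_fst
  have hsnd (x : α) : Continuous fun p : (α → α) × (α → α) => p.2 x :=
    (continuous_apply x).comp continuous_snd
  rw [range_relIso_coe_inv]
  simp only [Set.ofPred_and, Set.ofPred_forall]
  refine .inter ?_ (.inter ?_ ?_)
  · exact isClosed_iInter fun x => isClosed_eq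
      (heval.comp (continuous_fst.prodMk (hsnd x))) continuous_const
  · exact isClosed_iInter fun x => isClosed_eq
      (heval.comp (continuous_snd.prodMk (hfst x))) continuous_const
  · exact isClosed_iInter fun x => isClosed_iInter fun y =>
      (isClosed_discrete {q : α × α | r q.1 q.2 ↔ r x y}).preimage ((hfst x).prodMk (hfst y))

theorem isCompact_setOf_relIso_apply_mem {F F' : α → Set α} (hF : ∀ x, (F x).Finite)
    (hF' : ∀ x, (F' x).Finite) :
    IsCompact {σ : r ≃r r | (∀ x, σ x ∈ F x) ∧ ∀ x, σ⁻¹ x ∈ F' x} := by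
  convert isClosedEmbedding_relIso_coe_inv.isCompact_preimage
    ((isCompact_univ_pi fun x => (hF x).isCompact).prod
      (isCompact_univ_pi fun x => (hF' x).isCompact))
  ext σ
  simp [Set.mem_pi]

end PermutationTopology

section Graphs

variable {V W : Type*} {X : SimpleGraph V} {Y : SimpleGraph W}

theorem edist_map_le (f : X →g Y) (x y : V) : Y.edist (f x) (f y) ≤ X.edist x y := by
  by_cases h : X.Reachable x y
  · obtain ⟨p, hp⟩ := h.exists_walk_length_eq_edist
    rw [← hp, ← p.length_map f]
    exact SimpleGraph.edist_le _
  · rw [SimpleGraph.edist_eq_top_of_not_reachable h]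
    exact le_top

theorem edist_graphIso_apply (σ : X ≃g Y) (x y : V) : Y.edist (σ x) (σ y) = X.edist x y :=
  (edist_map_le σ.toHom x y).antisymm <| by
    simpa using edist_map_le σ.symm.toHom (σ x) (σ y)

theorem finite_setOf_edist_le (hfin : ∀ x, (X.neighborSet x).Finite) (R : ℕ) (x : V) :
    {y | X.edist x y ≤ R}.Finite := by
  induction R generalizing x with
  | zero => simp
  | succ R ih =>
    refine (((hfin x).biUnion fun z _ => ih z).insert x).subset fun y hy => ?_
    obtain ⟨p, hp⟩ := SimpleGraph.exists_walk_of_edist_ne_top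
      (ne_top_of_le_ne_top (ENat.natCast_ne_top _) (Set.mem_ofPred.1 hy))
    cases p with
    | nil => exact Set.mem_insert x _
    | @cons _ z _ hxz q =>
      have hq : q.length ≤ R := by
        have : (q.length + 1 : ℕ) ≤ ((R + 1 : ℕ) : ℕ∞) := hp.trans_le hy
        exact Nat.le_of_succ_le_succ (Nat.cast_le.1 this)
      exact .inr (Set.mem_biUnion hxz ((SimpleGraph.edist_le q).trans (Nat.cast_le.2 hq)))

variable [TopologicalSpace V] [DiscreteTopology V]

theorem isCompact_setOf_graphIso_apply_eq (hconn : X.Connected)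
    (hfin : ∀ x, (X.neighborSet x).Finite) (x y : V) : IsCompact {σ : X ≃g X | σ x = y} := by
  have hsphere (a b z : V) : {w | X.edist a w = X.edist b z}.Finite := by
    refine (finite_setOf_edist_le hfin (X.dist b z) a).subset fun w hw => ?_
    rw [Set.mem_ofPred, (hconn b z).coe_dist_eq_edist]
    exact hw.le
  refine (isCompact_setOf_relIso_apply_mem (hsphere y x) (hsphere x y)).of_isClosed_subset
    ((isClosed_discrete {y}).preimage (continuous_relIso_apply x)) ?_
  rintro σ rfl
  refine ⟨edist_graphIso_apply σ x, fun z => ?_⟩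
  rw [Set.mem_ofPred, ← edist_graphIso_apply σ, RelIso.apply_inv_self]

theorem locallyCompactSpace_graphIso (hconn : X.Connected)
    (hfin : ∀ x, (X.neighborSet x).Finite) : LocallyCompactSpace (X ≃g X) := by
  obtain ⟨x⟩ := hconn.nonempty
  exact (isCompact_setOf_graphIso_apply_eq hconn hfin x x).locallyCompactSpace_of_mem_nhds_of_group
    ((isOpen_setOf_relIso_apply_eq x x).mem_nhds (x := 1) rfl)

end Graphs

section Coverings

variable {V W : Type*} {X : SimpleGraph V} {Y : SimpleGraph W} {R : ℕ} {φ : V → W}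

/-- A covering of graphs at scale `R`: a graph homomorphism that lifts edges and is injective on
pairs of vertices at distance at most `R`. Surjectivity is not part of the definition; it is
automatic when the base is connected and the covering graph is nonempty. -/
structure IsCoveringAtScale (X : SimpleGraph V) (Y : SimpleGraph W) (R : ℕ) (φ : V → W) :
    Prop where
  map_adj {x y : V} : X.Adj x y → Y.Adj (φ x) (φ y)
  exists_lift {x : V} {z : W} : Y.Adj (φ x) z → ∃ y, X.Adj x y ∧ φ y = z
  eq_of_edist_le {x y : V} : X.edist x y ≤ R → φ x = φ y → x = y

/-- A graph is simply connected at scale `R` if its coverings at scale `R` by connected graphs are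
trivial. -/
def IsSimplyConnectedAtScale {V : Type u} (Y : SimpleGraph V) (R : ℕ) : Prop :=
  ∀ (W : Type u) (X : SimpleGraph W) (φ : W → V), X.Connected → IsCoveringAtScale X Y R φ →
    Function.Injective φ

namespace IsCoveringAtScale

theorem mono {R' : ℕ} (hφ : IsCoveringAtScale X Y R φ) (h : R' ≤ R) :
    IsCoveringAtScale X Y R' φ where
  map_adj := hφ.map_adj
  exists_lift := hφ.exists_lift
  eq_of_edist_le hxy := hφ.eq_of_edist_le (hxy.trans (Nat.cast_le.2 h))

theorem exists_lift_of_edist_le_one (hφ : IsCoveringAtScale X Y R φ) {x : V} {z : W}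
    (h : Y.edist (φ x) z ≤ 1) : ∃ y, X.edist x y ≤ 1 ∧ φ y = z := by
  rcases SimpleGraph.edist_le_one_iff_adj_or_eq.1 h with h | rfl
  · obtain ⟨y, hxy, rfl⟩ := hφ.exists_lift h
    exact ⟨y, SimpleGraph.edist_le_one_iff_adj_or_eq.2 (.inl hxy), rfl⟩
  · exact ⟨x, by simp, rfl⟩

theorem surjective [Nonempty V] (hφ : IsCoveringAtScale X Y R φ) (hY : Y.Connected) :
    Function.Surjective φ := by
  intro z
  obtain ⟨x⟩ := ‹Nonempty V›
  induction (SimpleGraph.reachable_iff_reflTransGen _ _).1 (hY (φ x) z) with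
  | refl => exact ⟨x, rfl⟩
  | tail _ hadj ih =>
    obtain ⟨y, rfl⟩ := ih
    obtain ⟨y', -, rfl⟩ := hφ.exists_lift hadj
    exact ⟨y', rfl⟩

theorem exists_graphIso (hφ : IsCoveringAtScale X Y R φ) (hbij : Function.Bijective φ) :
    ∃ σ : X ≃g Y, ∀ x, σ x = φ x := by
  refine ⟨⟨.ofBijective φ hbij, fun {x y} => ⟨fun h => ?_, hφ.map_adj⟩⟩, fun _ => rfl⟩
  obtain ⟨y', hxy', hy'⟩ := hφ.exists_lift h
  rwa [← hbij.1 hy']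

theorem of_locally_eq_graphIso (hR : 1 ≤ R)
    (hφ : ∀ x, ∃ σ : X ≃g Y, ∀ y, X.edist x y ≤ R → φ y = σ y) : IsCoveringAtScale X Y R φ := by
  have hadj {x y : V} (h : X.Adj x y) : X.edist x y ≤ R :=
    (SimpleGraph.edist_eq_one_iff_adj.2 h).trans_le (Nat.one_le_cast.2 hR)
  have hself (x : V) : X.edist x x ≤ R := by simp
  refine ⟨fun {x y} h => ?_, fun {x z} h => ?_, fun {x y} h hxy => ?_⟩ <;>
    obtain ⟨σ, hσ⟩ := hφ x
  · rwa [hσ x (hself x), hσ y (hadj h), σ.map_adj_iff]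
  · have hlift : X.Adj x (σ.symm z) := by
      rwa [← σ.map_adj_iff, RelIso.apply_symm_apply, ← hσ x (hself x)]
    exact ⟨_, hlift, by rw [hσ _ (hadj hlift), RelIso.apply_symm_apply]⟩
  · rw [hσ x (hself x), hσ y h] at hxy
    exact σ.injective hxy

end IsCoveringAtScale

end Coverings

section Rigidity

theorem exists_finite_forall_exists_smul_eq {H V : Type*} [Group H] [TopologicalSpace H]
    [TopologicalSpace V] [DiscreteTopology V] [Nonempty V] [MulAction H V]
    [MulAction.IsPretransitive H V] (hsmul : ∀ x : V, Continuous fun h : H => h • x)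
    {L : Subgroup H} (hL : IsCocompactSubgroup L) :
    ∃ F : Set V, F.Finite ∧ ∀ x, ∃ l : L, ∃ f ∈ F, l • f = x := by
  obtain ⟨K, hK, hLK⟩ := hL
  obtain ⟨x₀⟩ := ‹Nonempty V›
  refine ⟨(· • x₀) '' K, (hK.image (hsmul x₀)).finite_of_discrete, fun x => ?_⟩
  obtain ⟨h, rfl⟩ := MulAction.exists_smul_eq H x₀ x
  obtain ⟨l, hl, k, hk, rfl⟩ := hLK.ge (Set.mem_univ h)
  exact ⟨⟨l, hl⟩, _, ⟨k, hk, rfl⟩, (mul_smul l k x₀).symm⟩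

theorem exists_equivariant_extension {Γ H V : Type*} [Group Γ] [Group H] [MulAction H V]
    {ρ r : Γ →* H} {B : Set V} (hB : ∀ x, ∃ γ, ∃ b ∈ B, ρ γ • b = x)
    (hr : ∀ γ, ∀ b ∈ B, ρ γ • b ∈ B → r γ • b = ρ γ • b) :
    ∃ φ : V → V, (∀ b ∈ B, φ b = b) ∧ ∀ γ x, φ (ρ γ • x) = r γ • φ x := by
  have hwell {γ γ' : Γ} {b b' : V} (hb : b ∈ B) (hb' : b' ∈ B) (h : ρ γ • b = ρ γ' • b') :
      r γ • b = r γ' • b' := by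
    have hδ : ρ (γ'⁻¹ * γ) • b = b' := by
      rw [map_mul, map_inv, mul_smul, h, inv_smul_smul]
    have := hr (γ'⁻¹ * γ) b hb (hδ ▸ hb')
    rwa [hδ, map_mul, map_inv, mul_smul, inv_smul_eq_iff] at this
  choose g b hbB hgb using hB
  have hφ (γ : Γ) {b' : V} (hb' : b' ∈ B) : r (g (ρ γ • b')) • b (ρ γ • b') = r γ • b' :=
    hwell (hbB _) hb' (hgb _)
  refine ⟨fun x => r (g x) • b x, fun b hb => by simpa using hφ 1 hb, fun γ x => ?_⟩
  calc r (g (ρ γ • x)) • b (ρ γ • x)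
    _ = r (γ * g x) • b x := by rw [← hφ _ (hbB x), map_mul, mul_smul, hgb]
    _ = r γ • r (g x) • b x := by rw [map_mul, mul_smul]

variable {V : Type u} {X : SimpleGraph V} {R : ℕ}

theorem isCoveringAtScale_of_equivariant (hR : 1 ≤ R) {Γ : Type*} [Group Γ]
    {ρ r : Γ →* (X ≃g X)} {F : Set V} (hF : ∀ x, ∃ γ, ∃ f ∈ F, ρ γ • f = x) {φ : V → V}
    (hφ : ∀ f ∈ F, ∀ y, X.edist f y ≤ R → φ y = y) (hequiv : ∀ γ x, φ (ρ γ • x) = r γ • φ x) :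
    IsCoveringAtScale X X R φ := by
  refine .of_locally_eq_graphIso hR fun x => ?_
  obtain ⟨γ, f, hf, rfl⟩ := hF x
  refine ⟨r γ * (ρ γ)⁻¹, fun y hy => ?_⟩
  have hball : X.edist f ((ρ γ)⁻¹ y) ≤ R := by
    rwa [← edist_graphIso_apply (ρ γ), RelIso.apply_inv_self]
  calc φ y
    _ = φ (ρ γ • (ρ γ)⁻¹ y) := by rw [RelIso.smul_def, RelIso.apply_inv_self]
    _ = r γ ((ρ γ)⁻¹ y) := by rw [hequiv, hφ f hf _ hball, RelIso.smul_def]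

variable [TopologicalSpace V] [DiscreteTopology V]

theorem isOpen_setOf_forall_apply_eq (hconn : X.Connected)
    (hfin : ∀ x, (X.neighborSet x).Finite) (Γ : Subgroup (X ≃g X)) [DiscreteTopology Γ]
    {B : Set V} (hB : B.Finite) :
    IsOpen[representationTopology Γ (X ≃g X)] {r : Γ →* (X ≃g X) |
      ∀ γ : Γ, ∀ b ∈ B, (γ : X ≃g X) b ∈ B → r γ b = (γ : X ≃g X) b} := by
  let _ := representationTopology Γ (X ≃g X)
  have heval (γ : Γ) : Continuous fun r : Γ →* (X ≃g X) => r γ :=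
    (continuous_apply (A := fun _ => X ≃g X) γ).comp
      (continuous_induced_dom (f := fun r : Γ →* (X ≃g X) => (r : Γ → X ≃g X)))
  have hreturn (b b' : V) : {γ : Γ | (γ : X ≃g X) b = b'}.Finite :=
    isCompact_iff_finite.1 <|
      Γ.isClosed_of_discrete.isClosedEmbedding_subtypeVal.isCompact_preimage
        (isCompact_setOf_graphIso_apply_eq hconn hfin b b')
  have hopen : IsOpen (⋂ b ∈ B, ⋂ b' ∈ B, ⋂ γ ∈ {γ : Γ | (γ : X ≃g X) b = b'},
      {r : Γ →* (X ≃g X) | r γ b = b'}) :=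
    hB.isOpen_biInter fun b _ => hB.isOpen_biInter fun b' _ =>
      (hreturn b b').isOpen_biInter fun γ _ =>
        (isOpen_setOf_relIso_apply_eq b b').preimage (heval γ)
  convert hopen using 1
  ext r
  simp only [Set.mem_iInter, Set.mem_ofPred_eq]
  exact ⟨fun h b hb b' hb' γ hγ => hγ ▸ h γ b hb (hγ ▸ hb'), fun h γ b hb hb' => h b hb _ hb' γ rfl⟩

theorem isLocallyRigid_of_isSimplyConnectedAtScale [MulAction.IsPretransitive (X ≃g X) V]
    (hconn : X.Connected) (hfin : ∀ x, (X.neighborSet x).Finite)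
    (hX : IsSimplyConnectedAtScale X R) {Γ : Subgroup (X ≃g X)} (hΓ : IsUniformLattice Γ) :
    IsLocallyRigid Γ := by
  obtain ⟨_, hcocompact⟩ := hΓ
  have := hconn.nonempty
  obtain ⟨F, hF, hFcover⟩ := exists_finite_forall_exists_smul_eq
    (continuous_relIso_apply (r := X.Adj)) hcocompact
  let B : Set V := ⋃ f ∈ F, {y | X.edist f y ≤ (R + 1 : ℕ)}
  have hB : B.Finite := hF.biUnion fun f _ => finite_setOf_edist_le hfin (R + 1) f
  have hFB : F ⊆ B := fun f hf => Set.mem_biUnion hf (by simp)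
  refine ⟨_, isOpen_setOf_forall_apply_eq hconn hfin Γ hB, by simp, fun r hr => ?_⟩
  have hBcover (x : V) : ∃ γ, ∃ b ∈ B, Γ.subtype γ • b = x := by
    obtain ⟨γ, f, hf, hγ⟩ := hFcover x
    exact ⟨γ, f, hFB hf, hγ⟩
  obtain ⟨φ, hφB, hequiv⟩ := exists_equivariant_extension hBcover hr
  have hφ : IsCoveringAtScale X X (R + 1) φ :=
    isCoveringAtScale_of_equivariant R.succ_pos hFcover
      (fun f hf y hy => hφB y (Set.mem_biUnion hf hy)) hequiv
  obtain ⟨σ, hσ⟩ := hφ.exists_graphIso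
    ⟨hX V X φ hconn (hφ.mono R.le_succ), hφ.surjective hconn⟩
  refine ⟨σ, fun γ => eq_mul_inv_of_mul_eq (RelIso.ext fun x => ?_)⟩
  simpa only [hσ, RelIso.mul_apply, RelIso.smul_def, Subgroup.coe_subtype] using (hequiv γ x).symm

end Rigidity

section TopologicalGroups

variable {G : Type*} [Group G] [TopologicalSpace G]

theorem exists_isOpen_isCompact_subgroup_subset [IsTopologicalGroup G] {W : Set G}
    (hWo : IsOpen W) (hWc : IsCompact W) (h1W : 1 ∈ W) :
    ∃ U : Subgroup G, IsOpen (U : Set G) ∧ IsCompact (U : Set G) ∧ (U : Set G) ⊆ W := by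
  let U : Subgroup G := MulAction.stabilizer G W
  have hUo : IsOpen (U : Set G) := by
    obtain ⟨V, hV, hVW⟩ := compact_open_separated_mul_left hWc hWo subset_rfl
    have hsmul {v : G} (hv : v ∈ V) : v • W ⊆ W :=
      (Set.smul_set_subset_mul hv).trans hVW
    refine U.isOpen_of_mem_nhds (g := 1) ?_
    filter_upwards [hV, inv_mem_nhds_one G hV] with v hv hv'
    exact (hsmul hv).antisymm (Set.subset_smul_set_iff.2 (hsmul hv'))
  have hUW : (U : Set G) ⊆ W := fun g (hg : g • W = W) => hg ▸ ⟨1, h1W, mul_one g⟩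
  exact ⟨U, hUo, hWc.of_isClosed_subset (U.isClosed_of_isOpen hUo) hUW, hUW⟩

theorem exists_isOpen_isCompact_subgroup [IsTopologicalGroup G] [LocallyCompactSpace G]
    [TotallyDisconnectedSpace G] :
    ∃ U : Subgroup G, IsOpen (U : Set G) ∧ IsCompact (U : Set G) := by
  obtain ⟨K, hK, h1K⟩ := exists_compact_mem_nhds (1 : G)
  obtain ⟨W, hW, h1W, hWK⟩ := (loc_compact_Haus_tot_disc_of_zero_dim (H := G)).mem_nhds_iff.1 h1K
  obtain ⟨U, hUo, hUc, -⟩ := exists_isOpen_isCompact_subgroup_subset hW.isOpen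
    (hK.of_isClosed_subset hW.isClosed hWK) h1W
  exact ⟨U, hUo, hUc⟩

theorem isClosedEmbedding_of_isProperMap {H : Type*} [Group H] [TopologicalSpace H] [T1Space H]
    {f : G →* H} (hf : IsProperMap f)
    (hnormal : ∀ N : Subgroup G, N.Normal → IsCompact (N : Set G) → N = ⊥) :
    IsClosedEmbedding f := by
  have hker : IsCompact (f.ker : Set G) := by
    rw [MonoidHom.coe_ker]
    exact hf.isCompact_preimage isCompact_singleton
  exact .of_continuous_injective_isClosedMap hf.continuous
    (f.ker_eq_bot_iff.1 (hnormal _ inferInstance hker)) hf.isClosedMap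

theorem isProperMap_quotientGroup_mk [IsTopologicalGroup G] {U : Subgroup G}
    (hU : IsCompact (U : Set G)) : IsProperMap (QuotientGroup.mk : G → G ⧸ U) := by
  refine isProperMap_iff_isClosedMap_and_compact_fibers.2
    ⟨QuotientGroup.continuous_mk, QuotientGroup.isClosedMap_coe hU, fun x => ?_⟩
  obtain ⟨g, rfl⟩ := QuotientGroup.mk_surjective x
  convert hU.smul g
  ext h
  rw [Set.mem_smul_set_iff_inv_smul_mem]
  exact eq_comm.trans QuotientGroup.eq

theorem isCocompactSubgroup_of_isCompact_stabilizer {V : Type*} [MulAction G V] {L : Subgroup G}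
    [MulAction.IsPretransitive L V] {x : V} (hx : IsCompact (MulAction.stabilizer G x : Set G)) :
    IsCocompactSubgroup L := by
  refine ⟨_, hx, Set.eq_univ_of_forall fun g => ?_⟩
  obtain ⟨l, hl⟩ := MulAction.exists_smul_eq L x (g • x)
  refine ⟨l, l.2, (l : G)⁻¹ * g, ?_, mul_inv_cancel_left _ _⟩
  rw [SetLike.mem_coe, MulAction.mem_stabilizer_iff, mul_smul, ← hl]
  exact inv_smul_smul _ _

theorem isCompact_pow [ContinuousMul G] {T : Set G} (hT : IsCompact T) (n : ℕ) :
    IsCompact (T ^ n) := by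
  induction n with
  | zero => simp
  | succ n ih => exact pow_succ T n ▸ ih.mul hT

theorem exists_mem_insert_one_union_inv_pow {G : Type*} [Group G] {S : Set G}
    (hS : Subgroup.closure S = ⊤) (g : G) : ∃ n, g ∈ insert 1 (S ∪ S⁻¹) ^ n := by
  have hg : g ∈ Submonoid.closure (S ∪ S⁻¹) := by
    rw [← Subgroup.closure_toSubmonoid, hS]
    exact Submonoid.mem_top g
  induction hg using Submonoid.closure_induction with
  | one => exact ⟨0, by simp⟩
  | mem t ht => exact ⟨1, by simp [ht]⟩
  | mul g h _ _ hg hh =>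
    obtain ⟨m, hm⟩ := hg
    obtain ⟨n, hn⟩ := hh
    exact ⟨m + n, pow_add (insert 1 (S ∪ S⁻¹)) m n ▸ Set.mul_mem_mul hm hn⟩

-- By Baire, some power of `T` has nonempty interior, so the interiors of the powers cover `G`.
theorem exists_subset_pow_of_isCompact [IsTopologicalGroup G] [T2Space G] [LocallyCompactSpace G]
    {T : Set G} (hT : IsCompact T) (h1 : 1 ∈ T) (hcover : ∀ g, ∃ n, g ∈ T ^ n) {C : Set G}
    (hC : IsCompact C) : ∃ n, C ⊆ T ^ n := by
  obtain ⟨n, x, hx⟩ := nonempty_interior_of_iUnion_of_closed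
    (fun n => (isCompact_pow hT n).isClosed) (Set.iUnion_eq_univ_iff.2 hcover)
  have hinterior : C ⊆ ⋃ n, interior (T ^ n) := by
    intro g _
    obtain ⟨m, hm⟩ := hcover (g * x⁻¹)
    refine Set.mem_iUnion.2 ⟨m + n, interior_maximal ?_ (isOpen_interior.smul (g * x⁻¹))
      ⟨x, hx, inv_mul_cancel_right g x⟩⟩
    exact (Set.smul_set_subset_mul hm).trans
      (pow_add T m n ▸ Set.mul_subset_mul_left interior_subset)
  obtain ⟨k, hk⟩ := hC.elim_directed_cover (fun n => interior (T ^ n)) (fun _ => isOpen_interior)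
    hinterior
    (Monotone.directed_le fun _ _ h => interior_mono (Set.pow_subset_pow_right h1 h))
  exact ⟨k, hk.trans interior_subset⟩

end TopologicalGroups

section CayleyAbels

variable {G : Type u} [Group G] {U : Subgroup G} {S : Set G}

/-- The Cayley–Abels graph of `G` on the cosets of `U` with respect to `S`: the quotient by `U` of
the Cayley graph of `G`, with loops removed. -/
def cayleyAbelsGraph (U : Subgroup G) (S : Set G) : SimpleGraph (G ⧸ U) :=
  (SimpleGraph.mulCayley S).map QuotientGroup.mk

theorem cayleyAbelsGraph_adj {x y : G ⧸ U} : (cayleyAbelsGraph U S).Adj x y ↔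
    x ≠ y ∧ ∃ g : G, ∃ s ∈ S ∪ S⁻¹, (g : G ⧸ U) = x ∧ ((g * s : G) : G ⧸ U) = y := by
  refine and_congr_right fun hxy => ⟨?_, ?_⟩
  · rintro ⟨g, h, hgh, rfl, rfl⟩
    refine ⟨g, g⁻¹ * h, ?_, rfl, by rw [mul_inv_cancel_left]⟩
    simpa using ((SimpleGraph.mulCayley_adj S g h).1 hgh).2
  · rintro ⟨g, s, hs, rfl, rfl⟩
    have hgs : g ≠ g * s := fun h => hxy (congrArg _ h)
    exact ⟨g, g * s, (SimpleGraph.mulCayley_adj S _ _).2 ⟨hgs, by simpa using hs⟩, rfl, rfl⟩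

theorem cayleyAbelsGraph_edist_mul_le (g : G) {s : G} (hs : s ∈ S ∪ S⁻¹) :
    (cayleyAbelsGraph U S).edist (g : G ⧸ U) ((g * s : G) : G ⧸ U) ≤ 1 := by
  rw [SimpleGraph.edist_le_one_iff_adj_or_eq, or_iff_not_imp_right]
  exact fun h => cayleyAbelsGraph_adj.2 ⟨h, g, s, hs, rfl, rfl⟩

theorem cayleyAbelsGraph_connected (hS : Subgroup.closure S = ⊤) :
    (cayleyAbelsGraph U S).Connected := by
  refine (SimpleGraph.connected_iff_exists_forall_reachable _).2 ⟨((1 : G) : G ⧸ U), fun x => ?_⟩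
  obtain ⟨g, rfl⟩ := QuotientGroup.mk_surjective x
  have hg : g ∈ Subgroup.closure S := hS ▸ Subgroup.mem_top g
  have hstep (a : G) {s : G} (hs : s ∈ S ∪ S⁻¹) :
      (cayleyAbelsGraph U S).Reachable (a : G ⧸ U) ((a * s : G) : G ⧸ U) :=
    SimpleGraph.reachable_of_edist_ne_top
      (ne_top_of_le_ne_top ENat.one_ne_top (cayleyAbelsGraph_edist_mul_le a hs))
  induction hg using Subgroup.closure_induction_right with
  | one => exact .rfl
  | mul_right a _ s hs ih => exact ih.trans (hstep a (.inl hs))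
  | mul_inv_cancel a _ s hs ih => exact ih.trans (hstep a (.inr (Set.inv_mem_inv.2 hs)))

/-- Left translation by elements of `G` as automorphisms of the Cayley–Abels graph. -/
def cayleyAbelsTranslation (U : Subgroup G) (S : Set G) :
    G →* (cayleyAbelsGraph U S ≃g cayleyAbelsGraph U S) where
  toFun g :=
    { MulAction.toPerm g with
      map_rel_iff' := by
        have hsmul (g : G) {x y : G ⧸ U} (h : (cayleyAbelsGraph U S).Adj x y) :
            (cayleyAbelsGraph U S).Adj (g • x) (g • y) := by
          obtain ⟨hxy, a, s, hs, rfl, rfl⟩ := cayleyAbelsGraph_adj.1 h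
          exact cayleyAbelsGraph_adj.2 ⟨(MulAction.injective g).ne hxy, g * a, s, hs, rfl,
            congrArg _ (mul_assoc g a s)⟩
        exact fun {x y} => ⟨fun h => by simpa using hsmul g⁻¹ h, hsmul g⟩ }
  map_one' := RelIso.ext fun x => one_smul G x
  map_mul' g h := RelIso.ext fun x => mul_smul g h x

theorem cayleyAbelsTranslation_apply (g : G) (x : G ⧸ U) :
    cayleyAbelsTranslation U S g x = g • x := rfl

instance isPretransitive_range_cayleyAbelsTranslation :
    MulAction.IsPretransitive (cayleyAbelsTranslation U S).range (G ⧸ U) where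
  exists_smul_eq x y := by
    obtain ⟨g, rfl⟩ := MulAction.exists_smul_eq G x y
    exact ⟨⟨_, g, rfl⟩, rfl⟩

instance isPretransitive_graphIso_cayleyAbelsGraph :
    MulAction.IsPretransitive (cayleyAbelsGraph U S ≃g cayleyAbelsGraph U S) (G ⧸ U) where
  exists_smul_eq x y := by
    obtain ⟨σ, hσ⟩ := MulAction.exists_smul_eq (cayleyAbelsTranslation U S).range x y
    exact ⟨σ, hσ⟩

variable [TopologicalSpace G] [IsTopologicalGroup G]

theorem finite_neighborSet_cayleyAbelsGraph (hUo : IsOpen (U : Set G))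
    (hUc : IsCompact (U : Set G)) (hS : IsCompact S) (x : G ⧸ U) :
    ((cayleyAbelsGraph U S).neighborSet x).Finite := by
  have : DiscreteTopology (G ⧸ U) := QuotientGroup.discreteTopology hUo
  obtain ⟨g, rfl⟩ := QuotientGroup.mk_surjective x
  have hcompact : IsCompact
      ((fun h => ((g * h : G) : G ⧸ U)) '' ((U : Set G) * (S ∪ S⁻¹))) :=
    (hUc.mul (hS.union hS.inv)).image (QuotientGroup.continuous_mk.comp (continuous_const_mul g))
  refine hcompact.finite_of_discrete.subset fun y hy => ?_
  obtain ⟨-, a, s, hs, ha, rfl⟩ := cayleyAbelsGraph_adj.1 hy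
  exact ⟨_, ⟨g⁻¹ * a, QuotientGroup.eq.1 ha.symm, s, hs, rfl⟩, by simp [mul_assoc]⟩

theorem isProperMap_cayleyAbelsTranslation (hUo : IsOpen (U : Set G))
    (hUc : IsCompact (U : Set G)) : IsProperMap (cayleyAbelsTranslation U S) := by
  have : DiscreteTopology (G ⧸ U) := QuotientGroup.discreteTopology hUo
  have hcont : Continuous (cayleyAbelsTranslation U S) := by
    simp only [continuous_relIso_iff, ← map_inv, cayleyAbelsTranslation_apply]
    exact ⟨fun x => continuous_id.smul continuous_const,
      fun x => continuous_inv.smul continuous_const⟩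
  have hcomp : (fun σ : cayleyAbelsGraph U S ≃g cayleyAbelsGraph U S => σ ((1 : G) : G ⧸ U)) ∘
      cayleyAbelsTranslation U S = QuotientGroup.mk :=
    funext fun g => congrArg QuotientGroup.mk (mul_one g)
  exact isProperMap_of_comp_of_t2 hcont (continuous_relIso_apply _)
    (hcomp ▸ isProperMap_quotientGroup_mk hUc)

theorem isCocompactSubgroup_range_cayleyAbelsTranslation (hUo : IsOpen (U : Set G))
    (hUc : IsCompact (U : Set G)) (hSc : IsCompact S) (hS : Subgroup.closure S = ⊤) :
    IsCocompactSubgroup (cayleyAbelsTranslation U S).range := by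
  have : DiscreteTopology (G ⧸ U) := QuotientGroup.discreteTopology hUo
  exact isCocompactSubgroup_of_isCompact_stabilizer
    (isCompact_setOf_graphIso_apply_eq (cayleyAbelsGraph_connected hS)
      (finite_neighborSet_cayleyAbelsGraph hUo hUc hSc) ((1 : G) : G ⧸ U) _)

end CayleyAbels

section CosetPullback

variable {G : Type u} [Group G] {U : Subgroup G} {S : Set G} {V : Type u} {X : SimpleGraph V}
  {R : ℕ} {φ : V → G ⧸ U}

/-- The pull-back along `φ : V → G ⧸ U` of the projection of `G` onto `G ⧸ U`. If `φ` is a covering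
of a Cayley–Abels graph of `G`, then `G` acts on the pull-back of `φ` by path lifting. -/
abbrev CosetPullback (φ : V → G ⧸ U) : Type u :=
  Function.Pullback φ (QuotientGroup.mk : G → G ⧸ U)

namespace CosetPullback

theorem eq_of_edist_le (hφ : IsCoveringAtScale X (cayleyAbelsGraph U S) R φ)
    {p q : CosetPullback φ} (h : X.edist p.fst q.fst ≤ R) (hsnd : p.snd = q.snd) : p = q :=
  Subtype.ext (Prod.ext (hφ.eq_of_edist_le h (by rw [p.2, q.2]; exact congrArg _ hsnd)) hsnd)

theorem exists_step (hφ : IsCoveringAtScale X (cayleyAbelsGraph U S) R φ) {s : G}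
    (hs : s ∈ S ∪ S⁻¹) (p : CosetPullback φ) :
    ∃ q : CosetPullback φ, q.snd = p.snd * s⁻¹ ∧ X.edist p.fst q.fst ≤ 1 := by
  have hs' : s⁻¹ ∈ S ∪ S⁻¹ := by simpa [or_comm] using hs
  have hdist : (cayleyAbelsGraph U S).edist (φ p.fst) ↑(p.snd * s⁻¹) ≤ 1 :=
    p.2.symm ▸ cayleyAbelsGraph_edist_mul_le p.snd hs'
  obtain ⟨y, hy, hφy⟩ := hφ.exists_lift_of_edist_le_one hdist
  exact ⟨⟨(y, p.snd * s⁻¹), hφy⟩, rfl, hy⟩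

theorem exists_perm (hφ : IsCoveringAtScale X (cayleyAbelsGraph U S) R φ) (hR : 2 ≤ R) {s : G}
    (hs : s ∈ S) : ∃ π : Equiv.Perm (CosetPullback φ),
      ∀ p, (π p).snd = p.snd * s⁻¹ ∧ X.edist p.fst (π p).fst ≤ 1 := by
  choose f hf hfX using fun (t : ↥(S ∪ S⁻¹)) => exists_step hφ t.2
  have hff (t t' : ↥(S ∪ S⁻¹)) (htt' : (t * t' : G) = 1) (p : CosetPullback φ) :
      f t (f t' p) = p := by
    refine (eq_of_edist_le hφ ?_ ?_).symm
    · calc X.edist p.fst (f t (f t' p)).fst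
        _ ≤ X.edist p.fst (f t' p).fst + X.edist (f t' p).fst (f t (f t' p)).fst :=
          SimpleGraph.edist_triangle
        _ ≤ 1 + 1 := add_le_add (hfX t' p) (hfX t _)
        _ ≤ R := one_add_one_eq_two.trans_le (Nat.ofNat_le_cast.2 hR)
    · rw [hf, hf, mul_assoc, ← mul_inv_rev, htt', inv_one, mul_one]
  let t : ↥(S ∪ S⁻¹) := ⟨s, .inl hs⟩
  let t' : ↥(S ∪ S⁻¹) := ⟨s⁻¹, .inr (Set.inv_mem_inv.2 hs)⟩
  exact ⟨⟨f t, f t', hff t' t (inv_mul_cancel s), hff t t' (mul_inv_cancel s)⟩,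
    fun p => ⟨hf t p, hfX t p⟩⟩

theorem exists_freeGroup_action (hφ : IsCoveringAtScale X (cayleyAbelsGraph U S) R φ)
    (hR : 2 ≤ R) : ∃ ρ : FreeGroup S →* Equiv.Perm (CosetPullback φ), ∀ (L : List (S × Bool)) p,
      (ρ (.mk L) p).snd = p.snd * (FreeGroup.lift (Subtype.val : S → G) (.mk L))⁻¹ ∧
        X.edist p.fst (ρ (.mk L) p).fst ≤ L.length := by
  choose π hπ hπX using fun s : S => exists_perm hφ hR s.2
  let ρ : FreeGroup S →* Equiv.Perm (CosetPullback φ) := FreeGroup.lift π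
  have hletter (s : S) (b : Bool) (p : CosetPullback φ) :
      (ρ (.mk [(s, b)]) p).snd =
          p.snd * (FreeGroup.lift (Subtype.val : S → G) (.mk [(s, b)]))⁻¹ ∧
        X.edist p.fst (ρ (.mk [(s, b)]) p).fst ≤ 1 := by
    cases b with
    | true => simpa [ρ] using ⟨hπ s p, hπX s p⟩
    | false =>
      obtain ⟨q, rfl⟩ := (π s).surjective p
      simpa [ρ, hπ, SimpleGraph.edist_comm] using hπX s q
  refine ⟨ρ, fun L p => ?_⟩
  induction L with
  | nil => simp [← FreeGroup.one_eq_mk]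
  | cons c L ih =>
    obtain ⟨hsnd, hfst⟩ := hletter c.1 c.2 (ρ (.mk L) p)
    have hcons : FreeGroup.mk (c :: L) = .mk [c] * .mk L := by
      rw [FreeGroup.mul_mk, List.singleton_append]
    rw [hcons, map_mul, map_mul, Equiv.Perm.mul_apply]
    refine ⟨by rw [hsnd, ih.1, mul_inv_rev, mul_assoc], ?_⟩
    rw [List.length_cons, Nat.cast_add, Nat.cast_one]
    exact SimpleGraph.edist_triangle.trans (add_le_add ih.2 hfst)

-- A relator moves first coordinates by at most its length, hence acts trivially at scale `R`.
theorem exists_action [DecidableEq S] {rels : Set (FreeGroup S)}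
    (hsurj : Function.Surjective (FreeGroup.lift (Subtype.val : S → G)))
    (hrels : ∀ w ∈ rels, w.norm ≤ R)
    (hker : Subgroup.normalClosure rels = (FreeGroup.lift (Subtype.val : S → G)).ker)
    (hφ : IsCoveringAtScale X (cayleyAbelsGraph U S) R φ) (hR : 2 ≤ R) :
    ∃ ρ : G →* Equiv.Perm (CosetPullback φ), (∀ g p, (ρ g p).snd = p.snd * g⁻¹) ∧
      ∀ s ∈ S ∪ S⁻¹, ∀ p, X.edist p.fst (ρ s p).fst ≤ 1 := by
  obtain ⟨ρ, hρ⟩ := exists_freeGroup_action hφ hR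
  have hρker : (FreeGroup.lift (Subtype.val : S → G)).ker ≤ ρ.ker := by
    rw [← hker]
    refine Subgroup.normalClosure_le_normal fun w hw => MonoidHom.mem_ker.2 (Equiv.ext fun p => ?_)
    have hw1 : FreeGroup.lift (Subtype.val : S → G) w = 1 :=
      MonoidHom.mem_ker.1 (hker ▸ Subgroup.subset_normalClosure hw)
    have hwp := hρ w.toWord p
    rw [FreeGroup.mk_toWord, hw1, inv_one, mul_one] at hwp
    exact (eq_of_edist_le hφ (hwp.2.trans (Nat.cast_le.2 (hrels w hw))) hwp.1.symm).symm
  let ρ' : G →* Equiv.Perm (CosetPullback φ) :=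
    (FreeGroup.lift (Subtype.val : S → G)).liftOfSurjective hsurj ⟨ρ, hρker⟩
  have hρ' (w : FreeGroup S) : ρ' (FreeGroup.lift (Subtype.val : S → G) w) = ρ w :=
    MonoidHom.liftOfRightInverse_comp_apply _ _ _ ⟨ρ, hρker⟩ w
  refine ⟨ρ', fun g p => ?_, fun s hs p => ?_⟩
  · obtain ⟨w, rfl⟩ := hsurj g
    have hw := (hρ w.toWord p).1
    rwa [FreeGroup.mk_toWord, ← hρ'] at hw
  · obtain ⟨c, rfl⟩ : ∃ c : S × Bool, FreeGroup.lift (Subtype.val : S → G) (.mk [c]) = s := by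
      rcases hs with hs | hs
      · exact ⟨(⟨s, hs⟩, true), by simp⟩
      · exact ⟨(⟨s⁻¹, hs⟩, false), by simp⟩
    rw [hρ']
    simpa using (hρ [c] p).2

variable {ρ : G →* Equiv.Perm (CosetPullback φ)}

theorem edist_action_le (hstep : ∀ s ∈ S ∪ S⁻¹, ∀ p, X.edist p.fst (ρ s p).fst ≤ 1) {n : ℕ} {g : G}
    (hg : g ∈ insert 1 (S ∪ S⁻¹) ^ n) (p : CosetPullback φ) :
    X.edist p.fst (ρ g p).fst ≤ n := by
  induction n generalizing g with
  | zero =>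
    rw [pow_zero, Set.mem_one] at hg
    simp [hg]
  | succ n ih =>
    obtain ⟨t, ht, h, hh, rfl⟩ := pow_succ' (insert 1 (S ∪ S⁻¹)) n ▸ hg
    have htp (q : CosetPullback φ) : X.edist q.fst (ρ t q).fst ≤ 1 := by
      rcases ht with rfl | ht
      · simp
      · exact hstep t ht q
    simp only [map_mul, Equiv.Perm.mul_apply, Nat.cast_add, Nat.cast_one]
    exact SimpleGraph.edist_triangle.trans (add_le_add (ih hh) (htp _))

theorem action_fst_eq (hφ : IsCoveringAtScale X (cayleyAbelsGraph U S) R φ)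
    (hU : (U : Set G) ⊆ insert 1 (S ∪ S⁻¹) ^ R) (hsnd : ∀ g p, (ρ g p).snd = p.snd * g⁻¹)
    (hstep : ∀ s ∈ S ∪ S⁻¹, ∀ p, X.edist p.fst (ρ s p).fst ≤ 1) {u : G} (hu : u ∈ U)
    (p : CosetPullback φ) : (ρ u p).fst = p.fst := by
  refine (hφ.eq_of_edist_le (edist_action_le hstep (hU hu) p) ?_).symm
  calc φ p.fst
    _ = p.snd := p.2
    _ = (ρ u p).snd := by
      rw [hsnd, QuotientGroup.eq, inv_mul_cancel_left]
      exact U.inv_mem hu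
    _ = φ (ρ u p).fst := (ρ u p).2.symm

theorem exists_action_fst_eq_of_adj (hφ : IsCoveringAtScale X (cayleyAbelsGraph U S) R φ)
    (hR : 2 ≤ R) (hU : (U : Set G) ⊆ insert 1 (S ∪ S⁻¹) ^ R)
    (hsnd : ∀ g p, (ρ g p).snd = p.snd * g⁻¹)
    (hstep : ∀ s ∈ S ∪ S⁻¹, ∀ p, X.edist p.fst (ρ s p).fst ≤ 1) {p : CosetPullback φ} {z : V}
    (hz : X.Adj p.fst z) : ∃ g, (ρ g p).fst = z := by
  obtain ⟨-, a, s, hs, ha, has⟩ := cayleyAbelsGraph_adj.1 (hφ.map_adj hz)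
  have hu : a⁻¹ * p.snd ∈ U := QuotientGroup.eq.1 (ha.trans p.2)
  have hs' : s⁻¹ ∈ S ∪ S⁻¹ := by simpa [or_comm] using hs
  set q := ρ (a⁻¹ * p.snd) p
  have hq : q.snd = a := by rw [hsnd, mul_inv_rev, inv_inv, mul_inv_cancel_left]
  refine ⟨s⁻¹ * (a⁻¹ * p.snd), ?_⟩
  rw [map_mul, Equiv.Perm.mul_apply]
  refine hφ.eq_of_edist_le ?_ ?_
  · calc X.edist (ρ s⁻¹ q).fst z
      _ ≤ X.edist (ρ s⁻¹ q).fst q.fst + X.edist q.fst z := SimpleGraph.edist_triangle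
      _ ≤ 1 + 1 := by
        refine add_le_add (SimpleGraph.edist_comm.trans_le (hstep _ hs' q)) ?_
        rw [action_fst_eq hφ hU hsnd hstep hu p]
        exact (SimpleGraph.edist_eq_one_iff_adj.2 hz).le
      _ ≤ R := one_add_one_eq_two.trans_le (Nat.ofNat_le_cast.2 hR)
  · calc φ (ρ s⁻¹ q).fst
      _ = (ρ s⁻¹ q).snd := (ρ s⁻¹ q).2
      _ = φ z := by rw [hsnd, hq, inv_inv, has]

theorem exists_action_fst_eq (hX : X.Connected)
    (hφ : IsCoveringAtScale X (cayleyAbelsGraph U S) R φ) (hR : 2 ≤ R)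
    (hU : (U : Set G) ⊆ insert 1 (S ∪ S⁻¹) ^ R) (hsnd : ∀ g p, (ρ g p).snd = p.snd * g⁻¹)
    (hstep : ∀ s ∈ S ∪ S⁻¹, ∀ p, X.edist p.fst (ρ s p).fst ≤ 1) (p : CosetPullback φ) (z : V) :
    ∃ g, (ρ g p).fst = z := by
  induction (SimpleGraph.reachable_iff_reflTransGen _ _).1 (hX p.fst z) with
  | refl => exact ⟨1, by simp⟩
  | tail _ hadj ih =>
    obtain ⟨g, rfl⟩ := ih
    obtain ⟨h, rfl⟩ := exists_action_fst_eq_of_adj hφ hR hU hsnd hstep hadj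
    exact ⟨h * g, by rw [map_mul, Equiv.Perm.mul_apply]⟩

end CosetPullback

theorem isSimplyConnectedAtScale_cayleyAbelsGraph [DecidableEq S] {rels : Set (FreeGroup S)}
    (hsurj : Function.Surjective (FreeGroup.lift (Subtype.val : S → G)))
    (hrels : ∀ w ∈ rels, w.norm ≤ R)
    (hker : Subgroup.normalClosure rels = (FreeGroup.lift (Subtype.val : S → G)).ker)
    (hU : (U : Set G) ⊆ insert 1 (S ∪ S⁻¹) ^ R) (hR : 2 ≤ R) :
    IsSimplyConnectedAtScale (cayleyAbelsGraph U S) R := by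
  intro V X φ hX hφ x y hxy
  obtain ⟨ρ, hsnd, hstep⟩ := CosetPullback.exists_action hsurj hrels hker hφ hR
  obtain ⟨a, ha⟩ := QuotientGroup.mk_surjective (φ x)
  let p : CosetPullback φ := ⟨(x, a), ha.symm⟩
  obtain ⟨g, rfl⟩ := CosetPullback.exists_action_fst_eq hX hφ hR hU hsnd hstep p y
  have hg : g ∈ U := by
    have h : (a : G ⧸ U) = (ρ g p).snd := ha.trans (hxy.trans (ρ g p).2)
    rw [hsnd, QuotientGroup.eq] at h
    simpa [p, Function.Pullback.snd] using h
  exact (CosetPullback.action_fst_eq hφ hU hsnd hstep hg p).symm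

end CosetPullback

theorem corollary3_general (G : Type u) [Group G] [TopologicalSpace G] [IsTopologicalGroup G]
    [T2Space G] (hU : ∃ U : Subgroup G, IsOpen (U : Set G) ∧ IsCompact (U : Set G))
    (hpres : IsCompactlyPresented G) :
    ∃ (H : Type u) (_ : Group H) (_ : TopologicalSpace H) (_ : IsTopologicalGroup H)
      (_ : LocallyCompactSpace H) (_ : T2Space H) (ι : G →* H),
      IsProperMap ι ∧ IsCocompactSubgroup ι.range ∧
        ∀ Γ : Subgroup H, IsUniformLattice Γ → IsLocallyRigid Γ := by
  classical
  obtain ⟨U, hUo, hUc⟩ := hU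
  obtain ⟨S, rels, n, hSc, hsurj, hnorm, hker⟩ := hpres
  have hS : Subgroup.closure S = ⊤ := by
    rw [← MonoidHom.range_eq_top.2 hsurj, FreeGroup.range_lift_eq_closure, Subtype.range_val]
  have : LocallyCompactSpace G :=
    hUc.locallyCompactSpace_of_mem_nhds_of_group (hUo.mem_nhds U.one_mem)
  have : DiscreteTopology (G ⧸ U) := QuotientGroup.discreteTopology hUo
  obtain ⟨m, hm⟩ := exists_subset_pow_of_isCompact ((hSc.union hSc.inv).insert 1)
    (Set.mem_insert 1 _) (exists_mem_insert_one_union_inv_pow hS) hUc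
  have hconn := cayleyAbelsGraph_connected (U := U) hS
  have hfin := finite_neighborSet_cayleyAbelsGraph hUo hUc hSc
  have hsimply : IsSimplyConnectedAtScale (cayleyAbelsGraph U S) (m + n + 2) :=
    isSimplyConnectedAtScale_cayleyAbelsGraph hsurj (fun w hw => (hnorm w hw).trans (by omega)) hker
      (hm.trans (Set.pow_subset_pow_right (Set.mem_insert 1 _) (by omega))) (by omega)
  exact ⟨cayleyAbelsGraph U S ≃g cayleyAbelsGraph U S, inferInstance, inferInstance,
    inferInstance, locallyCompactSpace_graphIso hconn hfin, inferInstance,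
    cayleyAbelsTranslation U S, isProperMap_cayleyAbelsTranslation hUo hUc,
    isCocompactSubgroup_range_cayleyAbelsTranslation hUo hUc hSc hS,
    fun _ hΓ => isLocallyRigid_of_isSimplyConnectedAtScale hconn hfin hsimply hΓ⟩

theorem corollary3 (G : Type u) [Group G] [TopologicalSpace G] [IsTopologicalGroup G]
    [LocallyCompactSpace G] [TotallyDisconnectedSpace G]
    (hpres : IsCompactlyPresented G)
    (hnormal : ∀ N : Subgroup G, N.Normal → IsCompact (N : Set G) → N = ⊥) :
    ∃ (H : Type u) (_ : Group H) (_ : TopologicalSpace H) (_ : IsTopologicalGroup H)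
      (_ : LocallyCompactSpace H) (_ : T2Space H) (ι : G →* H),
      IsClosedEmbedding ι ∧ IsCocompactSubgroup ι.range ∧
        ∀ Γ : Subgroup H, IsUniformLattice Γ → IsLocallyRigid Γ := by
  obtain ⟨H, _, _, _, _, _, ι, hι, hcocompact, hrigid⟩ :=
    corollary3_general G exists_isOpen_isCompact_subgroup hpres
  exact ⟨H, _, _, ‹_›, ‹_›, ‹_›, ι, isClosedEmbedding_of_isProperMap hι hnormal, hcocompact, hrigid⟩
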